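/- **Lemma 5.1.** Let $N\ge 3$, $\alpha\ge 0$ and $2^*_\alpha=\frac{2(N+\alpha)}{N-2}$. For $R>0$ let $B_R=\{x\in\mathbb R^N:\ |x|<R\}$. Let $H^1_{0,\mathrm{rad}}(B_R)$ be the set of all $u\in H^1_0(B_R)$ (the closure of $C_c^\infty(B_R)$ in $H^1(B_R)$) with $u=u\circ O$ for every $O\in\mathcal O(N)$, and let $\mathcal D^{1,2}_{\mathrm{rad}}(\mathbb R^N)$ be the set of all radially symmetric $u\in\mathcal D^{1,2}(\mathbb R^N)$, where $\mathcal D^{1,2}(\mathbb R^N)$ is the completion of $C_c^\infty(\mathbb R^N)$ in the norm $\|\nabla u\|_{L^2}$, realised as a space of functions in $L^{2N/(N-2)}(\mathbb R^N)$. Set $$S_\alpha(B_R)=\inf_{u\in H^1_{0,\mathrm{rad}}(B_R)\setminus\{0\}}\frac{\int_{B_R}|\nabla u|^2\,dx}{\left(\int_{B_R}|u|^{2^*_\alpha}|x|^\alpha\,dx\right)^{2/2^*_\alpha}},\qquad S_\alpha(\mathbb R^N)=\inf_{u\in \mathcal D^{1,2}_{\mathrm{rad}}(\mathbb R^N)\setminus\{0\}}\frac{\int_{\mathbb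 R^N}|\nabla u|^2\,dx}{\left(\int_{\mathbb R^N}|u|^{2^*_\alpha}|x|^\alpha\,dx\right)^{2/2^*_\alpha}}.$$ Then $S_\alpha(B_R)=S_\alpha(\mathbb R^N)$ for every $R>0$. In particular, $S_\alpha(B_R)$ does not depend on $R$. -/

import Mathlib

open MeasureTheory Filter Topology
open scoped ENNReal ContDiff

namespace WeightedSobolev

/-- `φ` is a test function on `Ω`: smooth, with compact support contained in `Ω`. -/
def IsTestFunction {N : ℕ} (Ω : Set (EuclideanSpace ℝ (Fin N)))
    (φ : EuclideanSpace ℝ (Fin N) → ℝ) : Prop :=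
  ContDiff ℝ ∞ φ ∧ HasCompactSupport φ ∧ tsupport φ ⊆ Ω

/-- `G` is the weak (distributional) gradient of `u` on the open set `Ω`. -/
structure HasWeakGradientOn {N : ℕ} (Ω : Set (EuclideanSpace ℝ (Fin N)))
    (u : EuclideanSpace ℝ (Fin N) → ℝ)
    (G : EuclideanSpace ℝ (Fin N) → EuclideanSpace ℝ (Fin N)) : Prop where
  locallyIntegrableOn : LocallyIntegrableOn u Ω
  locallyIntegrableOn_grad : LocallyIntegrableOn G Ω
  integral_eq : ∀ φ, IsTestFunction Ω φ → ∀ v : EuclideanSpace ℝ (Fin N),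
    ∫ x in Ω, u x * fderiv ℝ φ x v = - ∫ x in Ω, inner ℝ (G x) v * φ x

/-- `u ∈ H¹₀(Ω)`: the function `u` belongs to `H¹(Ω)` (that is, `u` and its weak gradient are in
`L²(Ω)`) and is the limit, in the `H¹(Ω)` norm, of test functions on `Ω`.  Only the values of `u`
on `Ω` matter. -/
def MemH10 {N : ℕ} (Ω : Set (EuclideanSpace ℝ (Fin N)))
    (u : EuclideanSpace ℝ (Fin N) → ℝ) : Prop :=
  ∃ G : EuclideanSpace ℝ (Fin N) → EuclideanSpace ℝ (Fin N),
    HasWeakGradientOn Ω u G ∧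
    MemLp u 2 (volume.restrict Ω) ∧ MemLp G 2 (volume.restrict Ω) ∧
    ∃ φ : ℕ → EuclideanSpace ℝ (Fin N) → ℝ,
      (∀ n, IsTestFunction Ω (φ n)) ∧
      Tendsto (fun n => eLpNorm (u - φ n) 2 (volume.restrict Ω)) atTop (𝓝 0) ∧
      Tendsto (fun n => eLpNorm (G - gradient (φ n)) 2 (volume.restrict Ω)) atTop (𝓝 0)

/-- `u ∈ D^{1,2}(ℝ^N)` (for `N ≥ 3`): the completion of the test functions on `ℝ^N` for the norm
`‖∇u‖_{L²}`, realised as usual as a space of functions in `L^{2N/(N-2)}(ℝ^N)` having a weak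
gradient in `L²`. -/
def MemD12 {N : ℕ} (u : EuclideanSpace ℝ (Fin N) → ℝ) : Prop :=
  ∃ G : EuclideanSpace ℝ (Fin N) → EuclideanSpace ℝ (Fin N),
    HasWeakGradientOn Set.univ u G ∧
    MemLp u (ENNReal.ofReal (2 * (N : ℝ) / ((N : ℝ) - 2))) volume ∧ MemLp G 2 volume ∧
    ∃ φ : ℕ → EuclideanSpace ℝ (Fin N) → ℝ,
      (∀ n, IsTestFunction Set.univ (φ n)) ∧
      Tendsto (fun n => eLpNorm (u - φ n) (ENNReal.ofReal (2 * (N : ℝ) / ((N : ℝ) - 2))) volume)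
        atTop (𝓝 0) ∧
      Tendsto (fun n => eLpNorm (G - gradient (φ n)) 2 volume) atTop (𝓝 0)

/-- Radial symmetry on `Ω` (a ball or the whole space): `u ∘ O = u` almost everywhere on `Ω`, for
every orthogonal transformation `O`. -/
def IsRadialOn {N : ℕ} (Ω : Set (EuclideanSpace ℝ (Fin N)))
    (u : EuclideanSpace ℝ (Fin N) → ℝ) : Prop :=
  ∀ O : EuclideanSpace ℝ (Fin N) ≃ₗᵢ[ℝ] EuclideanSpace ℝ (Fin N),
    (fun x => u (O x)) =ᵐ[volume.restrict Ω] u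

/-- The critical exponent `2^*_α = 2(N+α)/(N-2)`. -/
noncomputable def critExp (N : ℕ) (α : ℝ) : ℝ :=
  2 * ((N : ℝ) + α) / ((N : ℝ) - 2)

/-- The quotient `∫_Ω |G|² dx / (∫_Ω |u|^{2^*_α} |x|^α dx)^{2/2^*_α}`, with the integrals taken
in `[0, ∞]`. -/
noncomputable def quotient {N : ℕ} (α : ℝ) (Ω : Set (EuclideanSpace ℝ (Fin N)))
    (u : EuclideanSpace ℝ (Fin N) → ℝ)
    (G : EuclideanSpace ℝ (Fin N) → EuclideanSpace ℝ (Fin N)) : ℝ≥0∞ :=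
  (∫⁻ x in Ω, ‖G x‖ₑ ^ 2) /
    (∫⁻ x in Ω, ‖u x‖ₑ ^ critExp N α * ‖x‖ₑ ^ α) ^ (2 / critExp N α)

/-- `S_α(B_R)`: the infimum of the quotient over the nonzero elements of `H¹_{0,rad}(B_R)`; here
`G` is the (almost everywhere unique) weak gradient of `u`. -/
noncomputable def SBall (N : ℕ) (α R : ℝ) : ℝ≥0∞ :=
  sInf {s | ∃ (u : EuclideanSpace ℝ (Fin N) → ℝ)
      (G : EuclideanSpace ℝ (Fin N) → EuclideanSpace ℝ (Fin N)),
    MemH10 (Metric.ball 0 R) u ∧ IsRadialOn (Metric.ball 0 R) u ∧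
    ¬ u =ᵐ[volume.restrict (Metric.ball 0 R)] 0 ∧
    HasWeakGradientOn (Metric.ball 0 R) u G ∧ s = quotient α (Metric.ball 0 R) u G}

/-- `S_α(ℝ^N)`: the infimum of the quotient over the nonzero elements of `D^{1,2}_rad(ℝ^N)`. -/
noncomputable def SSpace (N : ℕ) (α : ℝ) : ℝ≥0∞ :=
  sInf {s | ∃ (u : EuclideanSpace ℝ (Fin N) → ℝ)
      (G : EuclideanSpace ℝ (Fin N) → EuclideanSpace ℝ (Fin N)),
    MemD12 u ∧ IsRadialOn Set.univ u ∧ ¬ u =ᵐ[volume] 0 ∧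
    HasWeakGradientOn Set.univ u G ∧ s = quotient α Set.univ u G}

end WeightedSobolev

namespace WeightedSobolev

/-! Both inequalities come from moving competitors between the ball and the whole space. Extension
by zero preserves the quotient, and the Sobolev inequality places the extended function in
`D^{1,2}`; this gives `SSpace_le_SBall`.

For the converse, the exponent makes the quotient invariant under `u ↦ u(c ·)`, so all balls have
the same infimum (`SBall_le_SBall`). A competitor `u` on the whole space is multiplied by a radial
cutoff `η_r`, equal to 1 on `B_r` and supported in `B_{2r}`. The extra gradient term `u ∇η_r` lives
outside `B_r`. By Hölder with exponents `2N/(N-2)` and `N`, its `L²` norm is at most the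
`L^{2N/(N-2)}` norm of `u` outside `B_r` times `‖∇η_r‖_{L^N}`. The second factor does not depend on
`r` and the first tends to 0. Letting `r → ∞` gives `SBall_le_SSpace`.

The limit is taken in `S · D^{2/p} ≤ ‖G‖²`, with `p` the critical exponent and `D` the weighted
integral of `|u|^p`, so `D = ∞` is allowed and no weighted radial embedding is needed. -/

/-- `u` and `G` belong to `L²(Ω)` and are the `L²(Ω)` limits of a sequence of test functions on `Ω`
and of their gradients. -/
structure IsH10Pair {N : ℕ} (Ω : Set (EuclideanSpace ℝ (Fin N)))
    (u : EuclideanSpace ℝ (Fin N) → ℝ)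
    (G : EuclideanSpace ℝ (Fin N) → EuclideanSpace ℝ (Fin N)) : Prop where
  memLp : MemLp u 2 (volume.restrict Ω)
  memLp_grad : MemLp G 2 (volume.restrict Ω)
  exists_seq : ∃ φ : ℕ → EuclideanSpace ℝ (Fin N) → ℝ,
      (∀ n, IsTestFunction Ω (φ n)) ∧
      Tendsto (fun n => eLpNorm (u - φ n) 2 (volume.restrict Ω)) atTop (𝓝 0) ∧
      Tendsto (fun n => eLpNorm (G - gradient (φ n)) 2 (volume.restrict Ω)) atTop (𝓝 0)

/-! ### L² limits of test functions and weak gradients -/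

theorem tendsto_integral_mul_of_tendsto_eLpNorm_two {X : Type*} [MeasurableSpace X]
    {μ : Measure X} {u g : X → ℝ} {f : ℕ → X → ℝ} (hu : MemLp u 2 μ) (hg : MemLp g 2 μ)
    (hf : ∀ n, MemLp (f n) 2 μ)
    (h : Tendsto (fun n => eLpNorm (u - f n) 2 μ) atTop (𝓝 0)) :
    Tendsto (fun n => ∫ x, f n x * g x ∂μ) atTop (𝓝 (∫ x, u x * g x ∂μ)) := by
  refine tendsto_integral_of_L1' (fun x => u x * g x) (hu.1.mul hg.1)
    (Eventually.of_forall fun n => MemLp.integrable_mul (hf n) hg) ?_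
  have hlim : Tendsto (fun n => eLpNorm (u - f n) 2 μ * eLpNorm g 2 μ) atTop (𝓝 0) := by
    simpa using ENNReal.Tendsto.mul_const h (Or.inr hg.eLpNorm_ne_top)
  refine tendsto_of_tendsto_of_tendsto_of_le_of_le tendsto_const_nhds hlim
    (fun n => zero_le) fun n => ?_
  have h1 : eLpNorm ((u - f n) • g) 1 μ ≤ eLpNorm (u - f n) 2 μ * eLpNorm g 2 μ :=
    eLpNorm_smul_le_mul_eLpNorm hg.1 (hu.1.sub (hf n).1)
  refine le_trans (le_of_eq ?_) h1
  rw [← eLpNorm_neg]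
  congr 1
  ext x
  simp only [Pi.neg_apply, Pi.sub_apply, Pi.smul_apply', smul_eq_mul]
  ring

section

variable {N : ℕ}

local notation "E" => EuclideanSpace ℝ (Fin N)

theorem enorm_gradient (φ : E → ℝ) (x : E) : ‖gradient φ x‖ₑ = ‖fderiv ℝ φ x‖ₑ := by
  rw [← toDual_gradient, enorm_eq_nnnorm, enorm_eq_nnnorm,
    LinearIsometryEquiv.nnnorm_map (InnerProductSpace.toDual ℝ E)]

theorem eLpNorm_gradient (φ : E → ℝ) (p : ℝ≥0∞) (μ : Measure E) :
    eLpNorm (gradient φ) p μ = eLpNorm (fderiv ℝ φ) p μ :=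
  eLpNorm_congr_enorm_ae (Eventually.of_forall (enorm_gradient φ))

theorem continuous_gradient {φ : E → ℝ} (h : ContDiff ℝ ∞ φ) : Continuous (gradient φ) := by
  have : Continuous (fderiv ℝ φ) := h.continuous_fderiv (by simp)
  exact (InnerProductSpace.toDual ℝ E).symm.continuous.comp this

theorem support_gradient_subset (φ : E → ℝ) : Function.support (gradient φ) ⊆ tsupport φ := by
  intro x hx
  refine support_fderiv_subset ℝ ?_
  rw [Function.mem_support] at hx ⊢
  intro h0
  exact hx (by simp [gradient, h0])

theorem hasCompactSupport_gradient {φ : E → ℝ} (h : HasCompactSupport φ) :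
    HasCompactSupport (gradient φ) :=
  h.mono' (support_gradient_subset φ)

namespace IsTestFunction

variable {Ω : Set (EuclideanSpace ℝ (Fin N))} {φ : EuclideanSpace ℝ (Fin N) → ℝ}

theorem mono {Ω' : Set E} (h : IsTestFunction Ω φ) (hΩ : Ω ⊆ Ω') : IsTestFunction Ω' φ :=
  ⟨h.1, h.2.1, h.2.2.trans hΩ⟩

theorem memLp (h : IsTestFunction Ω φ) (p : ℝ≥0∞) (s : Set E) :
    MemLp φ p (volume.restrict s) :=
  (h.1.continuous.memLp_of_hasCompactSupport h.2.1).restrict s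

theorem memLp_gradient (h : IsTestFunction Ω φ) (p : ℝ≥0∞) (s : Set E) :
    MemLp (gradient φ) p (volume.restrict s) :=
  ((continuous_gradient h.1).memLp_of_hasCompactSupport (hasCompactSupport_gradient h.2.1)).restrict s

theorem eq_zero (h : IsTestFunction Ω φ) {x : E} (hx : x ∉ Ω) : φ x = 0 :=
  image_eq_zero_of_notMem_tsupport fun h' => hx (h.2.2 h')

theorem gradient_eq_zero (h : IsTestFunction Ω φ) {x : E} (hx : x ∉ Ω) : gradient φ x = 0 := by
  by_contra h0
  exact hx (h.2.2 (support_gradient_subset φ h0))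

theorem memLp_fderiv_apply (h : IsTestFunction Ω φ) (v : E) (p : ℝ≥0∞) (s : Set E) :
    MemLp (fun x => fderiv ℝ φ x v) p (volume.restrict s) := by
  have h1 : Continuous fun x => fderiv ℝ φ x v :=
    (h.1.continuous_fderiv (by simp)).clm_apply continuous_const
  exact (h1.memLp_of_hasCompactSupport (h.2.1.fderiv_apply ℝ v)).restrict s

/-- Integration by parts for smooth functions, one of which has compact support in `Ω`. -/
theorem setIntegral_mul_fderiv {ψ : E → ℝ} (h : IsTestFunction Ω φ) (hψ : IsTestFunction Ω ψ)
    (v : E) :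
    ∫ x in Ω, φ x * fderiv ℝ ψ x v = - ∫ x in Ω, inner ℝ (gradient φ x) v * ψ x := by
  have hzero : ∀ x, x ∉ Ω → φ x * fderiv ℝ ψ x v = 0 := fun x hx => by simp [h.eq_zero hx]
  have hzero' : ∀ x, x ∉ Ω → inner ℝ (gradient φ x) v * ψ x = 0 :=
    fun x hx => by simp [hψ.eq_zero hx]
  rw [setIntegral_eq_integral_of_forall_compl_eq_zero hzero,
    setIntegral_eq_integral_of_forall_compl_eq_zero hzero']
  simp only [inner_gradient_left]
  have hφ2 := h.memLp 2 Set.univ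
  have hψ2 := hψ.memLp 2 Set.univ
  have hdφ := h.memLp_fderiv_apply v 2 Set.univ
  have hdψ := hψ.memLp_fderiv_apply v 2 Set.univ
  rw [Measure.restrict_univ] at hφ2 hψ2 hdφ hdψ
  exact integral_mul_fderiv_eq_neg_fderiv_mul_of_integrable (hdφ.integrable_mul hψ2)
    (hφ2.integrable_mul hdψ) (hφ2.integrable_mul hψ2)
    (fun x _ => h.1.differentiable (by simp) x) (fun x _ => hψ.1.differentiable (by simp) x)

end IsTestFunction

theorem MemLp.locallyIntegrableOn_two {F : Type*} [NormedAddCommGroup F] {u : E → F} {Ω : Set E}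
    (hΩ : IsOpen Ω) (hu : MemLp u 2 (volume.restrict Ω)) : LocallyIntegrableOn u Ω := by
  rw [locallyIntegrableOn_iff hΩ.isLocallyClosed]
  intro K hK hKc
  have h1 : MemLp u 2 (volume.restrict K) := hu.mono_measure (Measure.restrict_mono hK le_rfl)
  have : IsFiniteMeasure (volume.restrict K) := ⟨by simpa using hKc.measure_lt_top⟩
  exact h1.integrable (by norm_num)

/-- Integration by parts holds for each approximating test function, and both sides are L² pairings
with a fixed function, so it survives the limit. -/
theorem IsH10Pair.hasWeakGradientOn {Ω : Set E} (hΩ : IsOpen Ω) {u : E → ℝ} {G : E → E}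
    (h : IsH10Pair Ω u G) : HasWeakGradientOn Ω u G := by
  refine ⟨MemLp.locallyIntegrableOn_two hΩ h.memLp, MemLp.locallyIntegrableOn_two hΩ h.memLp_grad,
    fun ψ hψ v => ?_⟩
  obtain ⟨φ, hφ, h1, h2⟩ := h.exists_seq
  have l1 := tendsto_integral_mul_of_tendsto_eLpNorm_two h.memLp (hψ.memLp_fderiv_apply v 2 Ω)
    (fun n => (hφ n).memLp 2 Ω) h1
  have h3 : Tendsto (fun n => eLpNorm ((fun x => inner ℝ (G x) v) -
      fun x => inner ℝ (gradient (φ n) x) v) 2 (volume.restrict Ω)) atTop (𝓝 0) := by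
    have hlim : Tendsto (fun n => ENNReal.ofReal ‖v‖ *
        eLpNorm (G - gradient (φ n)) 2 (volume.restrict Ω)) atTop (𝓝 0) := by
      simpa only [mul_zero] using ENNReal.Tendsto.const_mul h2 (Or.inr ENNReal.ofReal_ne_top)
    refine tendsto_of_tendsto_of_tendsto_of_le_of_le tendsto_const_nhds hlim
      (fun n => zero_le) fun n => ?_
    refine eLpNorm_le_mul_eLpNorm_of_ae_le_mul (Eventually.of_forall fun x => ?_) 2
    simp only [Pi.sub_apply, ← inner_sub_left]
    rw [mul_comm]
    exact norm_inner_le_norm _ _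
  have l2 := tendsto_integral_mul_of_tendsto_eLpNorm_two (h.memLp_grad.inner_const v)
    (hψ.memLp 2 Ω) (fun n => ((hφ n).memLp_gradient 2 Ω).inner_const v) h3
  refine tendsto_nhds_unique l1 (l2.neg.congr fun n => ?_)
  rw [(hφ n).setIntegral_mul_fderiv hψ v]

/-- This is the fundamental lemma of the calculus of variations for `G - G'`; the vector-valued
integral is tested against each direction `v`. -/
theorem HasWeakGradientOn.ae_unique {Ω : Set E} (hΩ : IsOpen Ω) {u : E → ℝ} {G G' : E → E}
    (h : HasWeakGradientOn Ω u G) (h' : HasWeakGradientOn Ω u G') :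
    G =ᵐ[volume.restrict Ω] G' := by
  have hG : LocallyIntegrableOn (fun x => G x - G' x) Ω :=
    h.locallyIntegrableOn_grad.sub h'.locallyIntegrableOn_grad
  have key : ∀ᵐ x ∂volume, x ∈ Ω → G x - G' x = 0 := by
    refine hΩ.ae_eq_zero_of_integral_contDiff_smul_eq_zero hG fun g hg hgc hgs => ?_
    have hi : ∀ {H : E → E}, LocallyIntegrableOn H Ω → Integrable (fun x => g x • H x) := by
      intro H hH
      have h1 : IntegrableOn (fun x => g x • H x) (tsupport g) :=
        (hH.integrableOn_compact_subset hgs hgc).continuousOn_smul hg.continuous.continuousOn hgc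
      refine (integrableOn_iff_integrable_of_support_subset ?_).1 h1
      intro x hx
      refine subset_tsupport _ ?_
      rw [Function.mem_support] at hx ⊢
      intro h0
      exact hx (by simp [h0])
    have hI := hi h.locallyIntegrableOn_grad
    have hI' := hi h'.locallyIntegrableOn_grad
    simp only [smul_sub]
    rw [integral_sub hI hI', sub_eq_zero]
    refine ext_inner_right ℝ fun v => ?_
    have hT : IsTestFunction Ω g := ⟨hg, hgc, hgs⟩
    have e1 := h.integral_eq g hT v
    have e2 := h'.integral_eq g hT v
    rw [e1, neg_inj] at e2
    have hc : ∀ {H : E → E}, Integrable (fun x => g x • H x) →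
        inner ℝ (∫ x, g x • H x) v = ∫ x in Ω, inner ℝ (H x) v * g x := by
      intro H hH
      rw [setIntegral_eq_integral_of_forall_compl_eq_zero
        (fun x hx => by simp [hT.eq_zero hx]), real_inner_comm, ← integral_inner hH]
      refine integral_congr_ae (Eventually.of_forall fun x => ?_)
      simp only [inner_smul_right, real_inner_comm]
      ring
    rw [hc hI, hc hI', e2]
  rw [Filter.EventuallyEq, ae_restrict_iff' hΩ.measurableSet]
  filter_upwards [key] with x hx hxΩ
  exact sub_eq_zero.1 (hx hxΩ)

theorem quotient_congr {α : ℝ} {Ω : Set E} {u : E → ℝ} {G G' : E → E}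
    (h : G =ᵐ[volume.restrict Ω] G') : quotient α Ω u G = quotient α Ω u G' := by
  unfold quotient
  congr 1
  exact lintegral_congr_ae (h.mono fun x hx => by simp only [hx])

theorem IsH10Pair.memH10 {Ω : Set E} (hΩ : IsOpen Ω) {u : E → ℝ} {G : E → E}
    (h : IsH10Pair Ω u G) : MemH10 Ω u :=
  ⟨G, h.hasWeakGradientOn hΩ, h.memLp, h.memLp_grad, h.exists_seq⟩

theorem SBall_le_quotient {α R : ℝ} {u : E → ℝ} {G : E → E}
    (h : IsH10Pair (Metric.ball 0 R) u G) (hr : IsRadialOn (Metric.ball 0 R) u)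
    (h0 : ¬ u =ᵐ[volume.restrict (Metric.ball 0 R)] 0) :
    SBall N α R ≤ quotient α (Metric.ball 0 R) u G :=
  sInf_le ⟨u, G, h.memH10 Metric.isOpen_ball, hr, h0, h.hasWeakGradientOn Metric.isOpen_ball, rfl⟩

/-- The gradient in the quotient and the one approximated in `MemH10` are quantified separately;
a.e. uniqueness lets a single `G` play both roles. -/
theorem le_SBall {α R : ℝ} {s : ℝ≥0∞}
    (h : ∀ (u : E → ℝ) (G : E → E), IsH10Pair (Metric.ball 0 R) u G →
      IsRadialOn (Metric.ball 0 R) u → ¬ u =ᵐ[volume.restrict (Metric.ball 0 R)] 0 →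
      s ≤ quotient α (Metric.ball 0 R) u G) : s ≤ SBall N α R := by
  refine le_sInf ?_
  rintro _ ⟨u, G, ⟨G', hG', hu2, hG2, hs⟩, hr, h0, hG, rfl⟩
  rw [quotient_congr (hG.ae_unique Metric.isOpen_ball hG')]
  exact h u G' ⟨hu2, hG2, hs⟩ hr h0

/-! ### Sobolev inequality and extension by zero -/

theorem critExp_pos (hN : 3 ≤ N) {α : ℝ} (hα : 0 ≤ α) : 0 < critExp N α := by
  have h3 : (3 : ℝ) ≤ N := by exact_mod_cast hN
  unfold critExp
  apply div_pos <;> linarith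

theorem exists_sobolev_const (hN : 3 ≤ N) : ∃ C : ℝ≥0∞, C ≠ ⊤ ∧ ∀ φ : E → ℝ,
    IsTestFunction Set.univ φ →
    eLpNorm φ (ENNReal.ofReal (2 * (N : ℝ) / ((N : ℝ) - 2))) volume ≤
      C * eLpNorm (gradient φ) 2 volume := by
  have h3 : (3 : ℝ) ≤ N := by exact_mod_cast hN
  refine ⟨SNormLESNormFDerivOfEqConst ℝ (volume : Measure E) 2, ENNReal.coe_ne_top,
    fun φ hφ => ?_⟩
  rw [eLpNorm_gradient]
  refine eLpNorm_le_eLpNorm_fderiv_of_eq (p := 2) volume (hφ.1.of_le (by simp)) hφ.2.1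
    (by norm_num) (by simp; omega) ?_
  rw [Real.coe_toNNReal _ (by apply div_nonneg <;> linarith), finrank_euclideanSpace_fin]
  have : (N : ℝ) - 2 ≠ 0 := by linarith
  have : (N : ℝ) ≠ 0 := by linarith
  push_cast
  field_simp

theorem IsTestFunction.sub {Ω : Set E} {φ ψ : E → ℝ} (h : IsTestFunction Ω φ)
    (h' : IsTestFunction Ω ψ) : IsTestFunction Ω (φ - ψ) := by
  refine ⟨h.1.sub h'.1, h.2.1.sub h'.2.1, ?_⟩
  exact (tsupport_sub φ ψ).trans (Set.union_subset h.2.2 h'.2.2)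

theorem IsTestFunction.gradient_sub {Ω : Set E} {φ ψ : E → ℝ} (h : IsTestFunction Ω φ)
    (h' : IsTestFunction Ω ψ) : gradient (φ - ψ) = gradient φ - gradient ψ := by
  ext1 x
  simp only [gradient, Pi.sub_apply]
  rw [fderiv_sub (h.1.differentiable (by simp) x) (h'.1.differentiable (by simp) x), map_sub]

theorem eLpNorm_indicator_sub {F : Type*} [NormedAddCommGroup F] {Ω : Set E}
    (hΩ : MeasurableSet Ω) (u φ : E → F) (hφ : ∀ x ∉ Ω, φ x = 0) (p : ℝ≥0∞) :
    eLpNorm (Ω.indicator u - φ) p volume = eLpNorm (u - φ) p (volume.restrict Ω) := by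
  rw [← eLpNorm_indicator_eq_eLpNorm_restrict hΩ]
  congr 1
  ext x
  by_cases hx : x ∈ Ω
  · simp [hx]
  · simp [hx, hφ x hx]

/-- The approximating test functions and their gradients already vanish off `Ω`, so the same
sequence serves on the whole space. -/
theorem IsH10Pair.indicator {Ω : Set E} (hΩ : IsOpen Ω) {u : E → ℝ} {G : E → E}
    (h : IsH10Pair Ω u G) : IsH10Pair Set.univ (Ω.indicator u) (Ω.indicator G) := by
  obtain ⟨φ, hφ, h1, h2⟩ := h.exists_seq
  refine ⟨?_, ?_, φ, fun n => (hφ n).mono (Set.subset_univ _), ?_, ?_⟩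
  · rw [Measure.restrict_univ]
    exact (memLp_indicator_iff_restrict hΩ.measurableSet).2 h.memLp
  · rw [Measure.restrict_univ]
    exact (memLp_indicator_iff_restrict hΩ.measurableSet).2 h.memLp_grad
  · refine h1.congr fun n => ?_
    rw [Measure.restrict_univ,
      eLpNorm_indicator_sub hΩ.measurableSet _ _ fun x hx => (hφ n).eq_zero hx]
  · refine h2.congr fun n => ?_
    rw [Measure.restrict_univ,
      eLpNorm_indicator_sub hΩ.measurableSet _ _ fun x hx => (hφ n).gradient_eq_zero hx]

/-- By the Sobolev inequality, `H¹(ℝ^N)` limits of test functions are in `D^{1,2}(ℝ^N)`. -/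
theorem IsH10Pair.memD12 (hN : 3 ≤ N) {u : E → ℝ} {G : E → E} (h : IsH10Pair Set.univ u G) :
    MemD12 u := by
  obtain ⟨C, hC, hS⟩ := exists_sobolev_const hN
  have hw := h.hasWeakGradientOn isOpen_univ
  obtain ⟨φ, hφ, h1, h2⟩ := h.exists_seq
  have hu := h.memLp
  have hG := h.memLp_grad
  rw [Measure.restrict_univ] at h1 h2 hu hG
  set q := ENNReal.ofReal (2 * (N : ℝ) / ((N : ℝ) - 2))
  have hmeas : ∀ n, AEStronglyMeasurable (φ n) volume :=
    fun n => (hφ n).1.continuous.aestronglyMeasurable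
  have hmeasG : ∀ n, AEStronglyMeasurable (gradient (φ n)) volume :=
    fun n => (continuous_gradient (hφ n).1).aestronglyMeasurable
  have h1' : Tendsto (fun n => eLpNorm (φ n - u) 2 volume) atTop (𝓝 0) := by
    simpa only [eLpNorm_sub_comm] using h1
  obtain ⟨ns, hns, hae⟩ :=
    (tendstoInMeasure_of_tendsto_eLpNorm (by norm_num) hmeas hu.1 h1').exists_seq_tendsto_ae
  -- Apply Sobolev to `φ (ns m) - φ n` and let `m → ∞`: Fatou handles the left side along the a.e.
  -- convergent subsequence.
  have key : ∀ n, eLpNorm (u - φ n) q volume ≤ C * eLpNorm (G - gradient (φ n)) 2 volume := by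
    intro n
    have hlim : Tendsto (fun m => C * (eLpNorm (G - gradient (φ (ns m))) 2 volume +
        eLpNorm (G - gradient (φ n)) 2 volume)) atTop
        (𝓝 (C * (0 + eLpNorm (G - gradient (φ n)) 2 volume))) :=
      ENNReal.Tendsto.const_mul ((h2.comp hns.tendsto_atTop).add tendsto_const_nhds) (Or.inr hC)
    rw [zero_add] at hlim
    rw [← hlim.liminf_eq]
    have hF := Lp.eLpNorm_lim_le_liminf_eLpNorm (p := q) (f := fun m => φ (ns m) - φ n)
      (fun m => (hmeas _).sub (hmeas n)) (u - φ n)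
      (hae.mono fun x hx => by simpa using hx.sub_const (φ n x))
    refine hF.trans (liminf_le_liminf (Eventually.of_forall fun m => ?_))
    refine (hS _ ((hφ (ns m)).sub (hφ n))).trans ?_
    gcongr
    rw [(hφ (ns m)).gradient_sub (hφ n)]
    have e : gradient (φ (ns m)) - gradient (φ n) =
        (G - gradient (φ n)) - (G - gradient (φ (ns m))) := by abel
    rw [e, add_comm]
    exact eLpNorm_sub_le (hG.1.sub (hmeasG _)) (hG.1.sub (hmeasG _)) (by norm_num)
  have hlim : Tendsto (fun n => C * eLpNorm (G - gradient (φ n)) 2 volume) atTop (𝓝 0) := by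
    simpa using ENNReal.Tendsto.const_mul h2 (Or.inr hC)
  have hq : Tendsto (fun n => eLpNorm (u - φ n) q volume) atTop (𝓝 0) :=
    tendsto_of_tendsto_of_tendsto_of_le_of_le tendsto_const_nhds hlim (fun n => zero_le) key
  refine ⟨G, hw, ?_, hG, φ, hφ, hq, h2⟩
  obtain ⟨n, hn⟩ := (hq.eventually (gt_mem_nhds ENNReal.zero_lt_top)).exists
  have h3 : MemLp (u - φ n) q volume := ⟨hu.1.sub (hmeas n), hn⟩
  have h4 := (hφ n).memLp q Set.univ
  rw [Measure.restrict_univ] at h4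
  simpa using h3.add h4

theorem IsRadialOn.indicator_ball {R : ℝ} {u : E → ℝ} (h : IsRadialOn (Metric.ball 0 R) u) :
    IsRadialOn Set.univ ((Metric.ball 0 R).indicator u) := by
  intro O
  have h1 := h O
  rw [Filter.EventuallyEq, ae_restrict_iff' Metric.isOpen_ball.measurableSet] at h1
  rw [Measure.restrict_univ]
  filter_upwards [h1] with x hx
  by_cases hxR : x ∈ Metric.ball 0 R
  · have : O x ∈ Metric.ball 0 R := by simpa using hxR
    rw [Set.indicator_of_mem hxR, Set.indicator_of_mem this, hx hxR]
  · have : O x ∉ Metric.ball 0 R := by simpa using hxR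
    rw [Set.indicator_of_notMem hxR, Set.indicator_of_notMem this]

theorem quotient_indicator {α : ℝ} (hp : 0 < critExp N α) {Ω : Set E} (hΩ : MeasurableSet Ω)
    (u : E → ℝ) (G : E → E) :
    quotient α Set.univ (Ω.indicator u) (Ω.indicator G) = quotient α Ω u G := by
  unfold quotient
  simp only [Measure.restrict_univ]
  rw [← lintegral_indicator hΩ, ← lintegral_indicator hΩ]
  congr 3
  · ext x
    by_cases hx : x ∈ Ω <;> simp [hx]
  · ext x
    by_cases hx : x ∈ Ω <;> simp [hx, hp]

theorem SSpace_le_SBall (hN : 3 ≤ N) {α : ℝ} (hα : 0 ≤ α) (R : ℝ) :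
    SSpace N α ≤ SBall N α R := by
  refine le_SBall fun u G h hr h0 => sInf_le ⟨_, (Metric.ball 0 R).indicator G,
    (h.indicator Metric.isOpen_ball).memD12 hN, hr.indicator_ball, fun h1 => h0 ?_,
    (h.indicator Metric.isOpen_ball).hasWeakGradientOn isOpen_univ,
    (quotient_indicator (critExp_pos hN hα) Metric.isOpen_ball.measurableSet u G).symm⟩
  rw [Filter.EventuallyEq, ae_restrict_iff' Metric.isOpen_ball.measurableSet]
  filter_upwards [h1] with x hx hxR
  rwa [Set.indicator_of_mem hxR] at hx

/-! ### Dilations -/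

theorem measurableEmbedding_smul {c : ℝ} (hc : c ≠ 0) :
    MeasurableEmbedding (fun x : E => c • x) :=
  (Homeomorph.smulOfNeZero c hc).measurableEmbedding

theorem map_smul_restrict_ball {c : ℝ} (hc : 0 < c) (R : ℝ) :
    Measure.map (fun x : E => c • x) (volume.restrict (Metric.ball 0 R)) =
      ENNReal.ofReal ((c ^ N)⁻¹) • volume.restrict (Metric.ball (0 : E) (c * R)) := by
  have hpre : Metric.ball (0 : E) R = (fun x : E => c • x) ⁻¹' Metric.ball (0 : E) (c * R) := by
    ext x
    simp [norm_smul, abs_of_pos hc, hc]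
  rw [hpre, ← (measurableEmbedding_smul hc.ne').restrict_map,
    Measure.map_addHaar_smul volume hc.ne', finrank_euclideanSpace_fin,
    abs_of_pos (by positivity), Measure.restrict_smul]

theorem lintegral_ball_comp_smul {c : ℝ} (hc : 0 < c) (R : ℝ) (f : E → ℝ≥0∞) :
    ∫⁻ x in Metric.ball (0 : E) R, f (c • x) =
      ENNReal.ofReal ((c ^ N)⁻¹) * ∫⁻ x in Metric.ball (0 : E) (c * R), f x := by
  rw [← (measurableEmbedding_smul hc.ne').lintegral_map f, map_smul_restrict_ball hc,
    lintegral_smul_measure, smul_eq_mul]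

theorem eLpNorm_two_ball_comp_smul {F : Type*} [NormedAddCommGroup F] {c : ℝ} (hc : 0 < c) (R : ℝ)
    (f : E → F) :
    eLpNorm (fun x => f (c • x)) 2 (volume.restrict (Metric.ball (0 : E) R)) =
      ENNReal.ofReal ((c ^ N)⁻¹) ^ (1 / (2 : ℝ≥0∞)).toReal *
        eLpNorm f 2 (volume.restrict (Metric.ball (0 : E) (c * R))) := by
  have h := (measurableEmbedding_smul hc.ne').eLpNorm_map_measure (g := f) (p := 2)
    (μ := volume.restrict (Metric.ball (0 : E) R))
  rw [map_smul_restrict_ball hc, eLpNorm_smul_measure_of_ne_top (by norm_num), smul_eq_mul] at h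
  exact h.symm

theorem memLp_ball_comp_smul {F : Type*} [NormedAddCommGroup F] {c : ℝ} (hc : 0 < c) {R : ℝ}
    {f : E → F} (hf : MemLp f 2 (volume.restrict (Metric.ball (0 : E) (c * R)))) :
    MemLp (fun x => f (c • x)) 2 (volume.restrict (Metric.ball (0 : E) R)) := by
  have h := (measurableEmbedding_smul hc.ne').memLp_map_measure_iff (g := f) (p := 2)
    (μ := volume.restrict (Metric.ball (0 : E) R))
  rw [map_smul_restrict_ball hc] at h
  exact h.1 (hf.smul_measure ENNReal.ofReal_ne_top)

theorem ae_ball_comp_smul {c : ℝ} (hc : 0 < c) (R : ℝ) (p : E → Prop) :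
    (∀ᵐ x ∂volume.restrict (Metric.ball (0 : E) R), p (c • x)) ↔
      ∀ᵐ x ∂volume.restrict (Metric.ball (0 : E) (c * R)), p x := by
  rw [← (measurableEmbedding_smul hc.ne').ae_map_iff, map_smul_restrict_ball hc,
    Measure.ae_ennreal_smul_measure_iff]
  simp only [ne_eq, ENNReal.ofReal_eq_zero, not_le]
  positivity

theorem gradient_comp_smul {φ : E → ℝ} (h : Differentiable ℝ φ) (c : ℝ) (x : E) :
    gradient (fun x => φ (c • x)) x = c • gradient φ (c • x) := by
  simp only [gradient]
  have h1 : HasFDerivAt (fun x : E => c • x) (c • ContinuousLinearMap.id ℝ E) x :=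
    (hasFDerivAt_id x).const_smul c
  have h2 : HasFDerivAt (fun x => φ (c • x)) _ x := (h (c • x)).hasFDerivAt.comp x h1
  rw [h2.fderiv, ContinuousLinearMap.comp_smul, ContinuousLinearMap.comp_id, map_smulₛₗ]
  simp

theorem IsTestFunction.comp_smul {c R : ℝ} (hc : 0 < c) {φ : E → ℝ}
    (h : IsTestFunction (Metric.ball 0 (c * R)) φ) :
    IsTestFunction (Metric.ball 0 R) (fun x => φ (c • x)) := by
  refine ⟨h.1.comp (contDiff_const_smul c),
    h.2.1.comp_homeomorph (Homeomorph.smulOfNeZero c hc.ne'), ?_⟩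
  intro x hx
  have h1 : c • x ∈ tsupport φ :=
    tsupport_comp_subset_preimage φ (continuous_const_smul c) hx
  have := h.2.2 h1
  simpa [norm_smul, abs_of_pos hc, hc] using this

theorem IsH10Pair.comp_smul {c R : ℝ} (hc : 0 < c) {u : E → ℝ} {G : E → E}
    (h : IsH10Pair (Metric.ball 0 (c * R)) u G) :
    IsH10Pair (Metric.ball 0 R) (fun x => u (c • x)) (fun x => c • G (c • x)) := by
  obtain ⟨φ, hφ, h1, h2⟩ := h.exists_seq
  have hK : ENNReal.ofReal ((c ^ N)⁻¹) ^ (1 / (2 : ℝ≥0∞)).toReal ≠ ⊤ :=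
    ENNReal.rpow_ne_top_of_nonneg (by positivity) ENNReal.ofReal_ne_top
  refine ⟨memLp_ball_comp_smul hc h.memLp, (memLp_ball_comp_smul hc h.memLp_grad).const_smul c,
    fun n x => φ n (c • x), fun n => (hφ n).comp_smul hc, ?_, ?_⟩
  · have := ENNReal.Tendsto.const_mul h1 (Or.inr hK)
    rw [mul_zero] at this
    exact this.congr fun n => (eLpNorm_two_ball_comp_smul hc R (u - φ n)).symm
  · have := ENNReal.Tendsto.const_mul (ENNReal.Tendsto.const_mul h2 (Or.inr hK))
      (Or.inr (enorm_ne_top (x := c)))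
    rw [mul_zero, mul_zero] at this
    refine this.congr fun n => ?_
    rw [← eLpNorm_two_ball_comp_smul hc R (G - gradient (φ n)), ← eLpNorm_const_smul]
    congr 1
    ext1 x
    simp only [Pi.smul_apply, Pi.sub_apply, smul_sub]
    rw [gradient_comp_smul ((hφ n).1.differentiable (by simp))]

/-- The numerator scales by `c^(2-N)` and the weighted integral by `c^(-(N+α))`; the critical
exponent is the one for which these powers cancel in the quotient. -/
theorem quotient_comp_smul (hN : 3 ≤ N) {α : ℝ} (hα : 0 ≤ α) {c : ℝ} (hc : 0 < c) (R : ℝ)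
    (u : E → ℝ) (G : E → E) :
    quotient α (Metric.ball 0 R) (fun x => u (c • x)) (fun x => c • G (c • x)) =
      quotient α (Metric.ball 0 (c * R)) u G := by
  have hp := critExp_pos hN hα
  have h3 : (3 : ℝ) ≤ N := by exact_mod_cast hN
  set γ := ENNReal.ofReal c with hγ
  have hγ0 : γ ≠ 0 := by simpa [hγ] using hc
  have hγt : γ ≠ ⊤ := ENNReal.ofReal_ne_top
  have hJ : ENNReal.ofReal ((c ^ N)⁻¹) = γ ^ (-(N : ℝ)) := by
    rw [hγ, ENNReal.ofReal_rpow_of_pos hc, Real.rpow_neg hc.le, Real.rpow_natCast]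
  have hcn : ‖c‖ₑ = γ := by rw [hγ, Real.enorm_eq_ofReal hc.le]
  have hnum : ∫⁻ x in Metric.ball (0 : E) R, ‖c • G (c • x)‖ₑ ^ 2 =
      γ ^ (2 - (N : ℝ)) * ∫⁻ x in Metric.ball (0 : E) (c * R), ‖G x‖ₑ ^ 2 := by
    simp only [enorm_smul, mul_pow, hcn]
    rw [lintegral_const_mul' _ _ (by finiteness),
      lintegral_ball_comp_smul hc R (fun x => ‖G x‖ₑ ^ 2), hJ, ← mul_assoc,
      sub_eq_add_neg, ENNReal.rpow_add _ _ hγ0 hγt, ENNReal.rpow_two]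
  have hden : ∫⁻ x in Metric.ball (0 : E) R, ‖u (c • x)‖ₑ ^ critExp N α * ‖x‖ₑ ^ α =
      γ ^ (-((N : ℝ) + α)) *
        ∫⁻ x in Metric.ball (0 : E) (c * R), ‖u x‖ₑ ^ critExp N α * ‖x‖ₑ ^ α := by
    -- The weight must be evaluated at `c • x` before changing variables, which costs a factor
    -- `c^(-α)`.
    have : ∀ x : E, ‖u (c • x)‖ₑ ^ critExp N α * ‖x‖ₑ ^ α =
        γ ^ (-α) * (‖u (c • x)‖ₑ ^ critExp N α * ‖c • x‖ₑ ^ α) := by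
      intro x
      rw [enorm_smul, hcn, ENNReal.mul_rpow_of_nonneg _ _ hα, ENNReal.rpow_neg]
      have e : (γ ^ α)⁻¹ * γ ^ α = 1 :=
        ENNReal.inv_mul_cancel (by simp [hγ0, hγt]) (ENNReal.rpow_ne_top_of_nonneg hα hγt)
      calc _ = ((γ ^ α)⁻¹ * γ ^ α) * (‖u (c • x)‖ₑ ^ critExp N α * ‖x‖ₑ ^ α) := by rw [e, one_mul]
        _ = _ := by ring
    simp only [this]
    rw [lintegral_const_mul' _ _ (by simp [ENNReal.rpow_neg, hγ0, hα]),
      lintegral_ball_comp_smul hc R (fun x => ‖u x‖ₑ ^ critExp N α * ‖x‖ₑ ^ α), hJ, ← mul_assoc,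
      ← ENNReal.rpow_add _ _ hγ0 hγt]
    congr 2
    ring
  unfold quotient
  rw [hnum, hden, ENNReal.mul_rpow_of_nonneg _ _ (by positivity), ← ENNReal.rpow_mul]
  have hexp : -((N : ℝ) + α) * (2 / critExp N α) = 2 - N := by
    unfold critExp
    have : (N : ℝ) - 2 ≠ 0 := by linarith
    have : (N : ℝ) + α ≠ 0 := by linarith
    field_simp
    ring
  rw [hexp]
  exact ENNReal.mul_div_mul_left _ _ (by simp [hγ0, hγt]) (by simp [hγ0, hγt])

theorem IsRadialOn.comp_smul {c R : ℝ} (hc : 0 < c) {u : E → ℝ}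
    (h : IsRadialOn (Metric.ball 0 (c * R)) u) :
    IsRadialOn (Metric.ball 0 R) (fun x => u (c • x)) := by
  intro O
  have := (ae_ball_comp_smul hc R fun x => u (O x) = u x).2 (h O)
  simpa only [Filter.EventuallyEq, map_smul] using this

/-- Dilation by `r / R` carries competitors on `B_r` to competitors on `B_R` with the same quotient.
The radii are arbitrary, so equality follows by exchanging them. -/
theorem SBall_le_SBall (hN : 3 ≤ N) {α : ℝ} (hα : 0 ≤ α) {R r : ℝ} (hR : 0 < R) (hr : 0 < r) :
    SBall N α R ≤ SBall N α r := by
  have hc : 0 < r / R := by positivity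
  have hcR : r = r / R * R := by field_simp
  refine le_SBall fun u G h hrad h0 => ?_
  rw [hcR] at h hrad h0 ⊢
  rw [← quotient_comp_smul hN hα hc]
  refine SBall_le_quotient (h.comp_smul hc) (hrad.comp_smul hc) fun h1 => h0 ?_
  exact (ae_ball_comp_smul hc R fun x => u x = 0).1 h1

/-! ### Radial cutoff functions -/

/-- A smooth radial function with values in `[0, 1]`, equal to `1` on the ball of radius `r` and
supported in the ball of radius `2 * r`. -/
noncomputable def cutoff (N : ℕ) (r : ℝ) (x : EuclideanSpace ℝ (Fin N)) : ℝ :=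
  Real.smoothTransition (2 - ‖r⁻¹ • x‖ ^ 2)

theorem cutoff_nonneg (r : ℝ) (x : E) : 0 ≤ cutoff N r x := Real.smoothTransition.nonneg _

theorem cutoff_le_one (r : ℝ) (x : E) : cutoff N r x ≤ 1 := Real.smoothTransition.le_one _

theorem norm_cutoff_le_one (r : ℝ) (x : E) : ‖cutoff N r x‖ ≤ 1 := by
  rw [Real.norm_of_nonneg (cutoff_nonneg r x)]
  exact cutoff_le_one r x

theorem contDiff_cutoff (r : ℝ) : ContDiff ℝ ∞ (cutoff N r) :=
  Real.smoothTransition.contDiff.comp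
    (contDiff_const.sub ((contDiff_norm_sq ℝ).comp (contDiff_const_smul r⁻¹)))

theorem cutoff_eq_one {r : ℝ} (hr : 0 < r) {x : E} (hx : x ∈ Metric.ball 0 r) :
    cutoff N r x = 1 := by
  refine Real.smoothTransition.one_of_one_le ?_
  rw [mem_ball_zero_iff] at hx
  have : ‖r⁻¹ • x‖ ≤ 1 := by
    rw [norm_smul, norm_inv, Real.norm_of_nonneg hr.le, inv_mul_le_one₀ hr]
    exact hx.le
  nlinarith [norm_nonneg (r⁻¹ • x)]

/-- The cutoff vanishes once `|x| ≥ √2 r`; the radius `3/2 * r` lies between `√2 r` and `2 * r`,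
leaving a compact support inside the open ball. -/
theorem tsupport_cutoff_subset {r : ℝ} (hr : 0 < r) :
    tsupport (cutoff N r) ⊆ Metric.closedBall 0 (3 / 2 * r) := by
  refine closure_minimal (fun x hx => ?_) Metric.isClosed_closedBall
  by_contra h
  rw [mem_closedBall_zero_iff, not_le] at h
  refine hx (Real.smoothTransition.zero_of_nonpos ?_)
  have : 3 / 2 ≤ ‖r⁻¹ • x‖ := by
    rw [norm_smul, norm_inv, Real.norm_of_nonneg hr.le, ← div_eq_inv_mul, le_div_iff₀ hr]
    exact h.le
  nlinarith

theorem isTestFunction_cutoff {r : ℝ} (hr : 0 < r) :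
    IsTestFunction (Metric.ball 0 (2 * r)) (cutoff N r) :=
  ⟨contDiff_cutoff r,
    (isCompact_closedBall (0 : E) (3 / 2 * r)).of_isClosed_subset (isClosed_tsupport _)
      (tsupport_cutoff_subset hr),
    (tsupport_cutoff_subset hr).trans (Metric.closedBall_subset_ball (by linarith))⟩

theorem cutoff_comp_isometry (r : ℝ) (O : E ≃ₗᵢ[ℝ] E) (x : E) :
    cutoff N r (O x) = cutoff N r x := by
  simp only [cutoff, norm_smul, LinearIsometryEquiv.norm_map]

theorem gradient_cutoff (r : ℝ) (x : E) :
    gradient (cutoff N r) x = r⁻¹ • gradient (cutoff N 1) (r⁻¹ • x) := by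
  rw [← gradient_comp_smul ((contDiff_cutoff 1).differentiable (by simp))]
  congr 1
  ext y
  simp [cutoff]

theorem gradient_cutoff_eq_zero {r : ℝ} (hr : 0 < r) {x : E} (hx : x ∈ Metric.ball 0 r) :
    gradient (cutoff N r) x = 0 := by
  have h : cutoff N r =ᶠ[𝓝 x] fun _ => 1 := by
    filter_upwards [Metric.isOpen_ball.mem_nhds hx] with y hy
    exact cutoff_eq_one hr hy
  rw [h.gradient_eq, gradient_fun_const]

theorem exists_norm_gradient_cutoff_le {r : ℝ} (hr : 0 < r) :
    ∃ C : ℝ, ∀ x : E, ‖gradient (cutoff N r) x‖ ≤ C :=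
  (continuous_gradient (contDiff_cutoff r)).bounded_above_of_compact_support
    (hasCompactSupport_gradient (isTestFunction_cutoff hr).2.1)

/-- The `L^N` norm of the gradient is invariant under dilations. -/
theorem eLpNorm_gradient_cutoff (hN : N ≠ 0) {r : ℝ} (hr : 0 < r) :
    eLpNorm (gradient (cutoff N r)) N volume = eLpNorm (gradient (cutoff N 1)) N volume := by
  have hr' : 0 < r⁻¹ := inv_pos.2 hr
  have h := (measurableEmbedding_smul (N := N) hr'.ne').eLpNorm_map_measure
    (g := gradient (cutoff N 1)) (p := N) (μ := volume)
  rw [Measure.map_addHaar_smul volume hr'.ne', finrank_euclideanSpace_fin,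
    eLpNorm_smul_measure_of_ne_top (ENNReal.natCast_ne_top N), smul_eq_mul] at h
  have e : gradient (cutoff N r) =
      r⁻¹ • (gradient (cutoff N 1) ∘ fun x : E => r⁻¹ • x) := by
    ext1 x
    exact gradient_cutoff r x
  -- The Jacobian `r^N` contributes `r` after the `N`-th root, cancelling the `r⁻¹` from the chain
  -- rule.
  have hc : ENNReal.ofReal |((r⁻¹ ^ N)⁻¹)| ^ (1 / (N : ℝ≥0∞)).toReal = ENNReal.ofReal r := by
    rw [inv_pow, inv_inv, abs_of_pos (by positivity), ENNReal.ofReal_pow hr.le,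
      ← ENNReal.rpow_natCast, ← ENNReal.rpow_mul, one_div, ENNReal.toReal_inv,
      ENNReal.toReal_natCast, mul_inv_cancel₀ (by exact_mod_cast hN), ENNReal.rpow_one]
  rw [e, eLpNorm_const_smul, ← h, hc, ← mul_assoc, Real.enorm_eq_ofReal hr'.le,
    ← ENNReal.ofReal_mul hr'.le, inv_mul_cancel₀ hr.ne', ENNReal.ofReal_one, one_mul]

/-! ### Truncation of functions in D^{1,2} -/

theorem holderTriple_sobolev (hN : 3 ≤ N) :
    ENNReal.HolderTriple (ENNReal.ofReal (2 * (N : ℝ) / ((N : ℝ) - 2))) N 2 := by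
  have h3 : (3 : ℝ) ≤ N := by exact_mod_cast hN
  have h2 : 0 < (N : ℝ) - 2 := by linarith
  have h0 : 0 < (N : ℝ) := by linarith
  have e2 : (2 : ℝ≥0∞) = ENNReal.ofReal 2 := by simp
  rw [ENNReal.holderTriple_iff, ← ENNReal.ofReal_natCast N, e2,
    ← ENNReal.ofReal_inv_of_pos (by positivity), ← ENNReal.ofReal_inv_of_pos h0,
    ← ENNReal.ofReal_inv_of_pos (by norm_num), ← ENNReal.ofReal_add (by positivity) (by positivity)]
  congr 1
  field_simp
  ring

/-- The gradient of the cutoff vanishes on `B_r`, so Hölder sees only the tail of `u`; dilation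
invariance of the `L^N` norm makes the constant independent of `r`. -/
theorem eLpNorm_smul_gradient_cutoff_le (hN : 3 ≤ N) {u : E → ℝ}
    (hu : AEStronglyMeasurable u volume) {r : ℝ} (hr : 0 < r) :
    eLpNorm (fun x => u x • gradient (cutoff N r) x) 2 volume ≤
      eLpNorm ((Metric.ball 0 r)ᶜ.indicator u)
        (ENNReal.ofReal (2 * (N : ℝ) / ((N : ℝ) - 2))) volume *
        eLpNorm (gradient (cutoff N 1)) N volume := by
  have := holderTriple_sobolev hN
  rw [← eLpNorm_gradient_cutoff (by omega) hr]
  have e : (fun x => u x • gradient (cutoff N r) x) =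
      ((Metric.ball 0 r)ᶜ.indicator u) • gradient (cutoff N r) := by
    ext1 x
    by_cases hx : x ∈ Metric.ball 0 r
    · simp [gradient_cutoff_eq_zero hr hx]
    · have hx' : x ∈ (Metric.ball (0 : E) r)ᶜ := hx
      rw [Pi.smul_apply', Set.indicator_of_mem hx']
  rw [e]
  exact eLpNorm_smul_le_mul_eLpNorm (continuous_gradient (contDiff_cutoff r)).aestronglyMeasurable
    (hu.indicator Metric.isOpen_ball.measurableSet.compl)

theorem tendsto_eLpNorm_indicator_compl_ball {u : E → ℝ} {q : ℝ≥0∞} (hq0 : q ≠ 0) (hq : q ≠ ⊤)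
    (hu : MemLp u q volume) :
    Tendsto (fun n : ℕ => eLpNorm ((Metric.ball 0 ((n : ℝ) + 1))ᶜ.indicator u) q volume)
      atTop (𝓝 0) := by
  have hqp : 0 < q.toReal := ENNReal.toReal_pos hq0 hq
  have h1 : Tendsto (fun n : ℕ => ∫⁻ x, ‖(Metric.ball (0 : E) ((n : ℝ) + 1))ᶜ.indicator u x‖ₑ ^
      q.toReal) atTop (𝓝 (∫⁻ _ : E, 0)) := by
    refine tendsto_lintegral_of_dominated_convergence' (fun x => ‖u x‖ₑ ^ q.toReal) (fun n => ?_)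
      (fun n => Eventually.of_forall fun x => ?_) ?_ (Eventually.of_forall fun x => ?_)
    · exact (hu.1.indicator Metric.isOpen_ball.measurableSet.compl).enorm.pow_const _
    · simp only [enorm_indicator_eq_indicator_enorm]
      exact ENNReal.rpow_le_rpow (Set.indicator_le_self _ _ _) hqp.le
    · exact ((eLpNorm_lt_top_iff_lintegral_rpow_enorm_lt_top hq0 hq).1 hu.2).ne
    · refine tendsto_const_nhds.congr' ?_
      filter_upwards [eventually_ge_atTop ⌈‖x‖⌉₊] with n hn
      have hx : x ∈ Metric.ball (0 : E) ((n : ℝ) + 1) := by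
        rw [mem_ball_zero_iff]
        have h2 : ‖x‖ ≤ n := (Nat.le_ceil _).trans (by exact_mod_cast hn)
        linarith
      have hx' : x ∉ (Metric.ball (0 : E) ((n : ℝ) + 1))ᶜ := fun h => h hx
      simp [Set.indicator_of_notMem hx', hqp]
  rw [lintegral_zero] at h1
  simp_rw [eLpNorm_eq_lintegral_rpow_enorm_toReal hq0 hq]
  have h2 := h1.ennrpow_const (1 / q.toReal)
  rwa [ENNReal.zero_rpow_of_pos (by positivity)] at h2

theorem gradient_mul {f g : E → ℝ} {x : E} (hf : DifferentiableAt ℝ f x)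
    (hg : DifferentiableAt ℝ g x) :
    gradient (fun x => f x * g x) x = f x • gradient g x + g x • gradient f x := by
  simp only [gradient]
  rw [fderiv_fun_mul hf hg, map_add, map_smulₛₗ, map_smulₛₗ]
  simp

/-- Multiplying an element of `D^{1,2}(ℝ^N)` by a cutoff function yields an element of
`H¹₀(B_{2r})`. -/
theorem isH10Pair_cutoff_mul (hN : 3 ≤ N) {r : ℝ} (hr : 0 < r) {u : E → ℝ} {G : E → E}
    (hu : MemLp u (ENNReal.ofReal (2 * (N : ℝ) / ((N : ℝ) - 2))) volume) (hG : MemLp G 2 volume)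
    {φ : ℕ → E → ℝ} (hφ : ∀ n, IsTestFunction Set.univ (φ n))
    (h1 : Tendsto (fun n => eLpNorm (u - φ n) (ENNReal.ofReal (2 * (N : ℝ) / ((N : ℝ) - 2)))
      volume) atTop (𝓝 0))
    (h2 : Tendsto (fun n => eLpNorm (G - gradient (φ n)) 2 volume) atTop (𝓝 0)) :
    IsH10Pair (Metric.ball 0 (2 * r)) (fun x => cutoff N r x * u x)
      (fun x => cutoff N r x • G x + u x • gradient (cutoff N r) x) := by
  have h3 : (3 : ℝ) ≤ N := by exact_mod_cast hN
  set q := ENNReal.ofReal (2 * (N : ℝ) / ((N : ℝ) - 2)) with hq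
  have h2q : 2 ≤ q := by
    rw [hq, show (2 : ℝ≥0∞) = ENNReal.ofReal 2 by simp]
    refine ENNReal.ofReal_le_ofReal ?_
    rw [le_div_iff₀] <;> linarith
  set μ := (volume : Measure E).restrict (Metric.ball 0 (2 * r)) with hμ
  have : IsFiniteMeasure μ := ⟨by simpa [hμ] using measure_ball_lt_top⟩
  -- `C` may depend on `r`: it only serves the approximation at fixed radius, not the limit `r → ∞`.
  obtain ⟨C, hC⟩ := exists_norm_gradient_cutoff_le (N := N) hr
  have hηm : AEStronglyMeasurable (cutoff N r) μ :=
    (contDiff_cutoff r).continuous.aestronglyMeasurable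
  have hdηm : AEStronglyMeasurable (gradient (cutoff N r)) μ :=
    (continuous_gradient (contDiff_cutoff r)).aestronglyMeasurable
  have hu2 : MemLp u 2 μ := (hu.restrict _).mono_exponent h2q
  have hG2 : MemLp G 2 μ := hG.restrict _
  have hφ2 : ∀ n, MemLp (φ n) 2 μ := fun n => (hφ n).memLp 2 _
  have hdφ2 : ∀ n, MemLp (gradient (φ n)) 2 μ := fun n => (hφ n).memLp_gradient 2 _
  have bound_smul : ∀ {F : Type} [NormedAddCommGroup F] [NormedSpace ℝ F] (v : E → F),
      eLpNorm (fun x => cutoff N r x • v x) 2 μ ≤ eLpNorm v 2 μ := by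
    intro F _ _ v
    refine eLpNorm_mono fun x => ?_
    rw [norm_smul]
    exact mul_le_of_le_one_left (norm_nonneg _) (norm_cutoff_le_one r x)
  have bound_grad : ∀ v : E → ℝ, eLpNorm (fun x => v x • gradient (cutoff N r) x) 2 μ ≤
      ENNReal.ofReal C * eLpNorm v 2 μ := by
    intro v
    refine eLpNorm_le_mul_eLpNorm_of_ae_le_mul (Eventually.of_forall fun x => ?_) 2
    rw [norm_smul, mul_comm]
    exact mul_le_mul_of_nonneg_right (hC x) (norm_nonneg _)
  -- On the ball, of finite measure, `L^q` convergence implies `L²` convergence because `q ≥ 2`.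
  have lim_u : Tendsto (fun n => eLpNorm (u - φ n) 2 μ) atTop (𝓝 0) := by
    have hK : μ Set.univ ^ (1 / (2 : ℝ≥0∞).toReal - 1 / q.toReal) ≠ ⊤ := by
      refine ENNReal.rpow_ne_top_of_nonneg ?_ (measure_ne_top μ _)
      rw [sub_nonneg]
      exact one_div_le_one_div_of_le (by simp) (ENNReal.toReal_mono (by simp [hq]) h2q)
    have hlim := ENNReal.Tendsto.mul_const h1 (Or.inr hK)
    rw [zero_mul] at hlim
    refine tendsto_of_tendsto_of_tendsto_of_le_of_le tendsto_const_nhds hlim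
      (fun n => zero_le) fun n => ?_
    refine (eLpNorm_le_eLpNorm_mul_rpow_measure_univ h2q (hu2.1.sub (hφ2 n).1)).trans ?_
    gcongr
    exact Measure.restrict_le_self
  have lim_G : Tendsto (fun n => eLpNorm (G - gradient (φ n)) 2 μ) atTop (𝓝 0) :=
    tendsto_of_tendsto_of_tendsto_of_le_of_le tendsto_const_nhds h2
      (fun n => zero_le) fun n => eLpNorm_mono_measure _ Measure.restrict_le_self
  refine ⟨⟨hηm.mul hu2.1, ?_⟩, ⟨(hηm.smul hG2.1).add (hu2.1.smul hdηm), ?_⟩,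
    fun n x => cutoff N r x * φ n x, fun n => ⟨(contDiff_cutoff r).mul (hφ n).1,
      (isTestFunction_cutoff hr).2.1.mul_right,
      (tsupport_mul_subset_left).trans (isTestFunction_cutoff hr).2.2⟩, ?_, ?_⟩
  · exact (bound_smul u).trans_lt hu2.2
  · refine (eLpNorm_add_le (hηm.smul hG2.1) (hu2.1.smul hdηm) (by norm_num)).trans_lt ?_
    exact ENNReal.add_lt_top.2 ⟨(bound_smul G).trans_lt hG2.2, (bound_grad u).trans_lt
      (ENNReal.mul_lt_top ENNReal.ofReal_lt_top hu2.2)⟩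
  · refine tendsto_of_tendsto_of_tendsto_of_le_of_le tendsto_const_nhds lim_u
      (fun n => zero_le) fun n => ?_
    refine le_trans (le_of_eq ?_) (bound_smul (u - φ n))
    congr 1
    ext x
    simp [mul_sub]
  · have hlim := lim_G.add (ENNReal.Tendsto.const_mul lim_u
      (Or.inr (ENNReal.ofReal_ne_top (r := C))))
    rw [mul_zero, add_zero] at hlim
    refine tendsto_of_tendsto_of_tendsto_of_le_of_le tendsto_const_nhds hlim
      (fun n => zero_le) fun n => ?_
    refine le_trans ?_ (add_le_add (bound_smul (G - gradient (φ n))) (bound_grad (u - φ n)))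
    refine le_trans (le_of_eq ?_) (eLpNorm_add_le (hηm.smul (hG2.1.sub (hdφ2 n).1))
      ((hu2.1.sub (hφ2 n).1).smul hdηm) (by norm_num))
    congr 1
    ext1 x
    simp only [Pi.sub_apply, Pi.add_apply]
    rw [gradient_mul ((contDiff_cutoff r).differentiable (by simp) x)
      ((hφ n).1.differentiable (by simp) x)]
    simp only [smul_sub, sub_smul]
    abel

/-! ### Passage to the limit -/

/-- In product form the bound also covers `u = 0`, so it applies to truncations without checking
that they are nonzero. -/
theorem SBall_mul_le {α R : ℝ} (hp : 0 < critExp N α) {u : E → ℝ} {G : E → E}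
    (h : IsH10Pair (Metric.ball 0 R) u G) (hr : IsRadialOn (Metric.ball 0 R) u) :
    SBall N α R * (∫⁻ x in Metric.ball 0 R, ‖u x‖ₑ ^ critExp N α * ‖x‖ₑ ^ α) ^ (2 / critExp N α) ≤
      eLpNorm G 2 (volume.restrict (Metric.ball 0 R)) ^ 2 := by
  by_cases h0 : u =ᵐ[volume.restrict (Metric.ball 0 R)] 0
  · have : ∫⁻ x in Metric.ball 0 R, ‖u x‖ₑ ^ critExp N α * ‖x‖ₑ ^ α = 0 := by
      rw [← lintegral_zero (μ := volume.restrict (Metric.ball (0 : E) R))]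
      exact lintegral_congr_ae (h0.mono fun x hx => by simp [hx, hp])
    rw [this, ENNReal.zero_rpow_of_pos (by positivity), mul_zero]
    exact zero_le
  · refine (ENNReal.mul_le_of_le_div (SBall_le_quotient h hr h0)).trans (le_of_eq ?_)
    have := eLpNorm_nnreal_pow_eq_lintegral (f := G)
      (μ := volume.restrict (Metric.ball (0 : E) R)) (p := 2) (by norm_num)
    simpa using this.symm

/-- The weight is positive away from the origin, which is a null set in positive dimension. -/
theorem lintegral_weighted_ne_zero {α : ℝ} (hN : N ≠ 0) {p : ℝ} (hp : 0 < p) {u : E → ℝ}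
    (hu : AEStronglyMeasurable u volume) (h0 : ¬ u =ᵐ[volume] 0) :
    ∫⁻ x, ‖u x‖ₑ ^ p * ‖x‖ₑ ^ α ≠ 0 := by
  intro h
  have hm : AEMeasurable (fun x : E => ‖u x‖ₑ ^ p * ‖x‖ₑ ^ α) volume :=
    (hu.enorm.pow_const _).mul (by fun_prop)
  rw [lintegral_eq_zero_iff' hm] at h
  refine h0 ?_
  have : Nontrivial E := by
    have : Nonempty (Fin N) := ⟨⟨0, Nat.pos_of_ne_zero hN⟩⟩
    infer_instance
  have hne : ∀ᵐ x : E, x ≠ 0 := by simp [ae_iff]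
  filter_upwards [h, hne] with x hx hx0
  simp only [Pi.zero_apply, mul_eq_zero] at hx
  rcases hx with hx | hx
  · simpa [ENNReal.rpow_eq_zero_iff, hp, hp.le] using hx
  · simp [ENNReal.rpow_eq_zero_iff, hx0] at hx

theorem SBall_le_SSpace (hN : 3 ≤ N) {α : ℝ} (hα : 0 ≤ α) {R : ℝ} (hR : 0 < R) :
    SBall N α R ≤ SSpace N α := by
  have h3 : (3 : ℝ) ≤ N := by exact_mod_cast hN
  have hp := critExp_pos hN hα
  refine le_sInf ?_
  rintro _ ⟨u, G, ⟨G', hG', huq, hG2, φ, hφ, h1, h2⟩, hr, h0, hG, rfl⟩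
  rw [quotient_congr (hG.ae_unique isOpen_univ hG')]
  unfold quotient
  rw [Measure.restrict_univ]
  have hD0 := lintegral_weighted_ne_zero (α := α) (by omega) hp huq.1 h0
  set D := ∫⁻ x : E, ‖u x‖ₑ ^ critExp N α * ‖x‖ₑ ^ α with hD
  have hnum : ∫⁻ x, ‖G' x‖ₑ ^ 2 = eLpNorm G' 2 volume ^ 2 := by
    have := eLpNorm_nnreal_pow_eq_lintegral (f := G') (μ := volume) (p := 2) (by norm_num)
    simpa using this.symm
  have hDpow : D ^ (2 / critExp N α) ≠ 0 := by
    intro h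
    rcases ENNReal.rpow_eq_zero_iff.1 h with h | h
    · exact hD0 h.1
    · have : 0 < 2 / critExp N α := by positivity
      linarith
  -- Clearing the denominator needs only `D^{2/p} ≠ 0` and a finite numerator; `D` itself may be
  -- infinite.
  rw [hnum, ENNReal.le_div_iff_mul_le (Or.inl hDpow)
    (Or.inr (ENNReal.pow_ne_top hG2.eLpNorm_ne_top))]
  set q := ENNReal.ofReal (2 * (N : ℝ) / ((N : ℝ) - 2)) with hq
  set K := eLpNorm (gradient (cutoff N 1)) N volume with hK
  have hKt : K ≠ ⊤ := by
    have := (isTestFunction_cutoff (N := N) one_pos).memLp_gradient N Set.univ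
    rw [Measure.restrict_univ] at this
    exact this.eLpNorm_ne_top
  have hq0 : q ≠ 0 := by
    have : 0 < 2 * (N : ℝ) / ((N : ℝ) - 2) := by apply div_pos <;> linarith
    simpa [hq] using this
  -- The shift by 1 keeps the radius positive at `n = 0` and puts every `x` in the open ball of
  -- index `⌈‖x‖⌉₊`.
  have hden : Tendsto (fun n : ℕ => ∫⁻ x in Metric.ball (0 : E) ((n : ℝ) + 1),
      ‖u x‖ₑ ^ critExp N α * ‖x‖ₑ ^ α) atTop (𝓝 D) := by
    have hmono : Monotone fun n : ℕ => Metric.ball (0 : E) ((n : ℝ) + 1) :=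
      fun m n hmn => Metric.ball_subset_ball (by gcongr)
    have hU : ⋃ n : ℕ, Metric.ball (0 : E) ((n : ℝ) + 1) = Set.univ := by
      refine Set.eq_univ_of_forall fun x => Set.mem_iUnion.2 ⟨⌈‖x‖⌉₊, ?_⟩
      rw [mem_ball_zero_iff]
      linarith [Nat.le_ceil ‖x‖]
    rw [hD, ← setLIntegral_univ, ← hU, setLIntegral_iUnion_of_directed _ hmono.directed_le]
    exact tendsto_atTop_iSup fun m n hmn => lintegral_mono_set (hmono hmn)
  have hL := ENNReal.Tendsto.const_mul (a := SBall N α R) (hden.ennrpow_const (2 / critExp N α))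
    (Or.inl hDpow)
  have hRhs : Tendsto (fun n : ℕ => (eLpNorm G' 2 volume +
      eLpNorm ((Metric.ball 0 ((n : ℝ) + 1))ᶜ.indicator u) q volume * K) ^ 2) atTop
      (𝓝 ((eLpNorm G' 2 volume + 0 * K) ^ 2)) :=
    ENNReal.Tendsto.pow (tendsto_const_nhds.add (ENNReal.Tendsto.mul_const
      (tendsto_eLpNorm_indicator_compl_ball hq0 ENNReal.ofReal_ne_top huq) (Or.inr hKt)))
  rw [zero_mul, add_zero] at hRhs
  refine le_of_tendsto_of_tendsto' hL hRhs fun n => ?_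
  have hn : (0 : ℝ) < (n : ℝ) + 1 := by positivity
  set r := (n : ℝ) + 1
  have hrad : IsRadialOn (Metric.ball 0 (2 * r)) (fun x => cutoff N r x * u x) := by
    intro O
    have h := hr O
    rw [Measure.restrict_univ] at h
    filter_upwards [ae_restrict_of_ae h] with x hx
    rw [cutoff_comp_isometry, hx]
  have hpair := isH10Pair_cutoff_mul hN hn huq hG2 hφ h1 h2
  -- The truncation is tested on `B_{2r}`, whose infimum is compared with that of `B_R` by dilation.
  -- Its weighted integral is at least that of `u` over `B_r`, where the cutoff is 1.
  refine le_trans ?_ ((SBall_mul_le hp hpair hrad).trans ?_)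
  · refine mul_le_mul' (SBall_le_SBall hN hα hR (by positivity))
      (ENNReal.rpow_le_rpow ?_ (by positivity))
    calc ∫⁻ x in Metric.ball (0 : E) r, ‖u x‖ₑ ^ critExp N α * ‖x‖ₑ ^ α
        = ∫⁻ x in Metric.ball (0 : E) r, ‖cutoff N r x * u x‖ₑ ^ critExp N α * ‖x‖ₑ ^ α :=
          setLIntegral_congr_fun Metric.isOpen_ball.measurableSet fun x hx => by
            simp only [cutoff_eq_one hn hx, one_mul]
      _ ≤ _ := lintegral_mono_set (Metric.ball_subset_ball (by linarith))
  · gcongr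
    have hm1 : AEStronglyMeasurable (fun x => cutoff N r x • G' x) volume :=
      (contDiff_cutoff r).continuous.aestronglyMeasurable.smul hG2.1
    have hm2 : AEStronglyMeasurable (fun x => u x • gradient (cutoff N r) x) volume :=
      huq.1.smul (continuous_gradient (contDiff_cutoff r)).aestronglyMeasurable
    refine (eLpNorm_mono_measure _ Measure.restrict_le_self).trans
      ((eLpNorm_add_le hm1 hm2 (by norm_num)).trans (add_le_add ?_ ?_))
    · refine eLpNorm_mono fun x => ?_
      rw [norm_smul]
      exact mul_le_of_le_one_left (norm_nonneg _) (norm_cutoff_le_one r x)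
    · exact eLpNorm_smul_gradient_cutoff_le hN huq.1 hn

end

end WeightedSobolev

theorem lemma5p1 (N : ℕ) (hN : 3 ≤ N) (α : ℝ) (hα : 0 ≤ α) :
    (∀ R : ℝ, 0 < R → WeightedSobolev.SBall N α R = WeightedSobolev.SSpace N α) ∧
    (∀ R₁ R₂ : ℝ, 0 < R₁ → 0 < R₂ →
      WeightedSobolev.SBall N α R₁ = WeightedSobolev.SBall N α R₂) := by
  have h : ∀ R : ℝ, 0 < R → WeightedSobolev.SBall N α R = WeightedSobolev.SSpace N α :=
    fun R hR => le_antisymm (WeightedSobolev.SBall_le_SSpace hN hα hR)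
      (WeightedSobolev.SSpace_le_SBall hN hα R)
  exact ⟨h, fun R₁ R₂ h₁ h₂ => (h R₁ h₁).trans (h R₂ h₂).symm⟩
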